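/- Let $0<\mu<\lambda$ and $x>0$. A particle on the real line starts at $x$ and moves with velocity $+1$ during a time $U_1$, then with velocity $-1$ during a time $D_1$, then with velocity $+1$ during a time $U_2$, and so on. Here $U_1,U_2,\dots,D_1,D_2,\dots$ are independent, each $U_i$ is exponential with rate $\lambda$ and each $D_i$ is exponential with rate $\mu$. Let $C_x$ be the first time $t>0$ at which the particle is at the origin, and let $C_0$ be the corresponding time for the motion started at $0$. Then $C_x$ and $C_0$ are almost surely finite. For every $s<(\sqrt\lambda-\sqrt\mu)^2/2$ the moment generating functions $M_{C_x}(s)=\mathbb E(e^{sC_x})$ and $M_{C_0}(s)=\mathbb E(e^{sC_0})$ are finite, and $$M_{C_x}(s)=M_{C_0}(s)\,\exp\Big\{\tfrac x2\Big[\lambda-\mu-\sqrt{(\lambda+\mu-2s)^2-4\lambda\mu}\,\Big]\Big\}.$$ For every integer $n\ge 1$ the $n$-th moment of $C_x$ is finite and $$\mathbb E(C_x^n)=n!\,\frac{\lambda}{\lambda+\mu}\,e^{\frac x2(\lambda-\mu)}\,\frac{2^n}{(\lambda+\mu)^n}\sum_{h=0}^{n}\left(-\frac{\lambda+\mu}{(\sqrt\lambda-\sqrt\mu)^2}\right)^{h}{}_2F_1\!\left(\tfrac{1+n-h}{2},\tfrac{2+n-h}{2};2;\tfrac{4\lambda\mu}{(\lambda+\mu)^2}\right)\sum_{j=0}^{\infty}\left[-\frac{(\lambda-\mu)x}{2}\right]^{j}\frac1{j!}\,B_h\!\left(\tfrac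 j2\right),$$ where the series over $j$ converge, $$B_h(a)=\binom{a}{h}\;{}_2F_1\!\left(-h,-a;a+1-h;\left(\tfrac{\sqrt\lambda-\sqrt\mu}{\sqrt\lambda+\sqrt\mu}\right)^{2}\right),\qquad \binom{a}{h}=\frac{a(a-1)\cdots(a-h+1)}{h!},$$ and ${}_2F_1(a,b;c;z)=\sum_{k\ge0}\frac{(a)_k(b)_k}{(c)_k}\frac{z^k}{k!}$ is the Gauss hypergeometric function, with $(d)_k=d(d+1)\cdots(d+k-1)$. For those $j$ for which $\tfrac j2+1-h$ is a nonpositive integer, so that ${}_2F_1$ is not defined by its series, $B_h(\tfrac j2)$ denotes the limit of $B_h(a)$ as $a\to\tfrac j2$ (the limit exists). -/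

import Mathlib

open MeasureTheory ProbabilityTheory Filter Topology

namespace Telegraph

noncomputable section

/-- Starting time of the `k`-th (up, down) pair of periods (counted from `0`), when the upward
periods last `u 0, u 1, …` and the downward periods last `d 0, d 1, …`. -/
def cycleStart (u d : ℕ → ℝ) (k : ℕ) : ℝ := ∑ i ∈ Finset.range k, (u i + d i)

/-- The part of `[0, t]` that lies in the `k`-th upward period, which occupies the time interval
from `cycleStart u d k` to `cycleStart u d k + u k`. -/
def upTime (u d : ℕ → ℝ) (k : ℕ) (t : ℝ) : ℝ :=
  max 0 (min (t - cycleStart u d k) (u k))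

/-- The part of `[0, t]` that lies in the `k`-th downward period, which occupies the time interval
from `cycleStart u d k + u k` to `cycleStart u d (k + 1)`. -/
def downTime (u d : ℕ → ℝ) (k : ℕ) (t : ℝ) : ℝ :=
  max 0 (min (t - (cycleStart u d k + u k)) (d k))

/-- Position at time `t` of a particle which starts at `x`, and moves with velocity `1` during the
upward periods and `-1` during the downward periods (without any boundary). Only finitely many
terms of the series are nonzero when the cycle starting times tend to infinity. -/
def position (x : ℝ) (u d : ℕ → ℝ) (t : ℝ) : ℝ :=
  x + ∑' k : ℕ, (upTime u d k t - downTime u d k t)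

/-- The set of positive times at which the particle is at the origin. -/
def hitTimes (x : ℝ) (u d : ℕ → ℝ) : Set ℝ := {t : ℝ | 0 < t ∧ position x u d t = 0}

/-- The time of the first arrival at the origin. -/
def firstArrival (x : ℝ) (u d : ℕ → ℝ) : ℝ := sInf (hitTimes x u d)

/-- The random time `C_x` till the first arrival at the origin, for the motion that starts at `x`
and has the random upward periods `U i` and downward periods `D i`. -/
def arrivalTime {Ω : Type*} (x : ℝ) (U D : ℕ → Ω → ℝ) (ω : Ω) : ℝ :=
  firstArrival x (fun i => U i ω) (fun i => D i ω)

/-- The generalized binomial coefficient `a (a - 1) ⋯ (a - h + 1) / h!`. -/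
def gbinom (a : ℝ) (h : ℕ) : ℝ := (∏ i ∈ Finset.range h, (a - i)) / (h.factorial : ℝ)

/-- The product of the generalized binomial coefficient `a choose h` and
`₂F₁(-h, -a; a + 1 - h; z)`, literally, with no convention. -/
def binomHypRaw (h : ℕ) (z a : ℝ) : ℝ :=
  gbinom a h * ₂F₁ (-(h : ℝ)) (-a) (a + 1 - h) z

open Classical in
/-- The same product, at every real `a`. If `a + 1 - h` is not one of `0, -1, -2, …`, it is the
literal product. Otherwise the hypergeometric function has a pole in its third parameter, and
the product is read as its limit in `a`. -/
def binomHyp (h : ℕ) (z a : ℝ) : ℝ :=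
  if ∃ k : ℕ, a + 1 - h = -(k : ℝ) then limUnder (𝓝[≠] a) (binomHypRaw h z)
  else binomHypRaw h z a

/-- The `j`-th term of the series that multiplies the `h`-th hypergeometric value in the formula
for the moments. -/
def momentTerm (lam mu x : ℝ) (h j : ℕ) : ℝ :=
  (-((lam - mu) * x / 2)) ^ j * (1 / (j.factorial : ℝ)) *
    binomHyp h (((√lam - √mu) / (√lam + √mu)) ^ 2) ((j : ℝ) / 2)

end

end Telegraph

open scoped ENNReal

namespace Telegraph

noncomputable section

/-! ### The path up to its first arrival at the origin -/

/-! Write `R` for the square root of `disc lam mu s`, `psi = (lam - mu - R) / 2` and `G = returnMgf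
lam mu s`. Conditioning on the first cycle turns the expectation of `exp (s * T)`, as a function of
the starting point `y`, into a fixed point of a monotone operator. The function `G * exp (y * psi)`
is such a fixed point because `mu * G = mu - s + psi` and `G * (lam - s - psi) = lam`; hence `psi`
is a root of `(lam - s - c) * (mu - s + c) = lam * mu` in `c`. Iterating the operator from `0` gives
the expectation restricted to arrival within `n` cycles (`lintegral_arrivalExp`). The iterates stay
below the fixed point, and the gap decays geometrically (`iSup_meanArrivalExp`): it is compared with
`exp (y * c)` for `c` midway between the two roots, where the product exceeds `lam * mu` by `disc
lam mu s / 4 > 0`. Monotone convergence gives the moment generating function. At `s = 0` its value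
is `1`, so arrival is almost sure; the value at `y = 0` is `G`, whence the factorization.

The moments are `n!` times the Taylor coefficients at `0` (`integral_pow_eq`). Up to the constant
`exp (x / 2 * (lam - mu))`, the generating function is the product of two power series in `s`. The
factor `G` is a Catalan series in `lam * mu / (lam + mu - 2 * s) ^ 2`; expanding each power by the
negative binomial series gives the values ₂F₁(·, ·; 2; ·). In the factor `exp (-(x / 2 * R))`, the
discriminant splits as a constant times `(1 + t) * (1 + z * t)` with `t` proportional to `s`.
Expanding the exponential and then each power `j / 2` of this product gives the convolutions
`binomConv`, which are the terminating hypergeometric values `binomHyp`. Absolute majorants justify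
both exchanges of summation. -/

/-- The sequence without its first term. -/
def shift (v : ℕ → ℝ) : ℕ → ℝ := fun i => v (i + 1)

lemma cycleStart_succ_eq_add_shift (u d : ℕ → ℝ) (k : ℕ) :
    cycleStart u d (k + 1) = u 0 + d 0 + cycleStart (shift u) (shift d) k := by
  simp only [cycleStart, shift, Finset.sum_range_succ', add_comm]

lemma cycleStart_succ (u d : ℕ → ℝ) (k : ℕ) :
    cycleStart u d (k + 1) = cycleStart u d k + (u k + d k) := by
  simp only [cycleStart, Finset.sum_range_succ]

lemma upTime_succ (u d : ℕ → ℝ) (k : ℕ) (t : ℝ) :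
    upTime u d (k + 1) t = upTime (shift u) (shift d) k (t - (u 0 + d 0)) := by
  simp only [upTime, cycleStart_succ_eq_add_shift, sub_sub, shift]

lemma downTime_succ (u d : ℕ → ℝ) (k : ℕ) (t : ℝ) :
    downTime u d (k + 1) t = downTime (shift u) (shift d) k (t - (u 0 + d 0)) := by
  simp only [downTime, cycleStart_succ_eq_add_shift, sub_sub, shift, add_assoc]

section Path

variable {u d : ℕ → ℝ}

lemma cycleStart_monotone (hu : ∀ i, 0 < u i) (hd : ∀ i, 0 < d i) :
    Monotone (cycleStart u d) :=
  monotone_nat_of_le_succ fun k => by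
    rw [cycleStart_succ]; linarith [hu k, hd k]

lemma position_eq_sum (hu : ∀ i, 0 < u i) (hd : ∀ i, 0 < d i) (x : ℝ) {n : ℕ} {t : ℝ}
    (ht : t ≤ cycleStart u d n) :
    position x u d t = x + ∑ k ∈ Finset.range n, (upTime u d k t - downTime u d k t) := by
  rw [position, tsum_eq_sum]
  intro k hk
  have h1 : t ≤ cycleStart u d k :=
    ht.trans (cycleStart_monotone hu hd (by simpa using hk))
  rw [upTime, downTime, max_eq_left, max_eq_left, sub_zero]
  · exact (min_le_left _ _).trans (by linarith [hu k])
  · exact (min_le_left _ _).trans (by linarith)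

lemma position_of_le_up (hu : ∀ i, 0 < u i) (hd : ∀ i, 0 < d i) (x : ℝ) {t : ℝ} (h0 : 0 ≤ t)
    (ht : t ≤ u 0) : position x u d t = x + t := by
  rw [position_eq_sum hu hd x (n := 1) (by simp [cycleStart]; linarith [hd 0])]
  simp only [Finset.range_one, Finset.sum_singleton, upTime, downTime, cycleStart,
    Finset.range_zero, Finset.sum_empty, sub_zero, zero_add, min_eq_left ht, max_eq_right h0]
  rw [max_eq_left ((min_le_left _ _).trans (by linarith)), sub_zero]

lemma position_of_le_down (hu : ∀ i, 0 < u i) (hd : ∀ i, 0 < d i) (x : ℝ) {t : ℝ} (h0 : u 0 ≤ t)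
    (ht : t ≤ u 0 + d 0) : position x u d t = x + 2 * u 0 - t := by
  rw [position_eq_sum hu hd x (n := 1) (by simpa [cycleStart])]
  simp only [Finset.range_one, Finset.sum_singleton, upTime, downTime, cycleStart,
    Finset.range_zero, Finset.sum_empty, sub_zero, zero_add, min_eq_right h0,
    max_eq_right (hu 0).le]
  rw [min_eq_left (by linarith), max_eq_right (by linarith)]
  ring

lemma position_eq_position_shift (hu : ∀ i, 0 < u i) (hd : ∀ i, 0 < d i) (x : ℝ) {n : ℕ} {t : ℝ}
    (h0 : u 0 + d 0 ≤ t) (ht : t ≤ cycleStart u d (n + 1)) :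
    position x u d t =
      position (x + u 0 - d 0) (shift u) (shift d) (t - (u 0 + d 0)) := by
  have hu' : ∀ i, 0 < shift u i := fun i => hu (i + 1)
  have hd' : ∀ i, 0 < shift d i := fun i => hd (i + 1)
  rw [position_eq_sum hu hd x ht, position_eq_sum hu' hd' _ (n := n)
    (by rw [cycleStart_succ_eq_add_shift] at ht; linarith), Finset.sum_range_succ']
  simp only [upTime_succ, downTime_succ]
  have h1 : upTime u d 0 t = u 0 := by
    rw [upTime, min_eq_right (by simp [cycleStart]; linarith [hd 0]), max_eq_right (hu 0).le]
  have h2 : downTime u d 0 t = d 0 := by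
    rw [downTime, min_eq_right (by simp [cycleStart]; linarith), max_eq_right (hd 0).le]
  rw [h1, h2]; ring

end Path

/-- For a motion that starts at `y`: the exponential of `s` times the time of the first arrival at
the origin if this arrival happens during the first `n` cycles, and `0` otherwise. -/
def arrivalExp (s : ℝ) : ℕ → ℝ → (ℕ → ℝ) → (ℕ → ℝ) → ℝ≥0∞
  | 0, _, _, _ => 0
  | n + 1, y, u, d =>
    if y + u 0 ≤ d 0 then ENNReal.ofReal (Real.exp (s * (y + 2 * u 0)))
    else ENNReal.ofReal (Real.exp (s * (u 0 + d 0))) *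
      arrivalExp s n (y + u 0 - d 0) (shift u) (shift d)

lemma arrivalExp_mono (s : ℝ) (y : ℝ) (u d : ℕ → ℝ) :
    Monotone fun n => arrivalExp s n y u d := by
  refine monotone_nat_of_le_succ fun n => ?_
  induction n generalizing y u d with
  | zero => simp [arrivalExp]
  | succ n ih =>
    rw [arrivalExp, arrivalExp]
    split_ifs
    · exact le_rfl
    · exact mul_le_mul_right (ih _ _ _) _

/-- The path is lowest at the ends of a cycle. If the first cycle ends above the origin, there is no
positive zero during it and the first arrival is that of the restarted motion, delayed by `u 0 + d
0`. The time `T` is the same for every `s`. -/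
lemma arrivalExp_eq_zero_or (n : ℕ) {y : ℝ} (hy : 0 ≤ y) {u d : ℕ → ℝ}
    (hu : ∀ i, 0 < u i) (hd : ∀ i, 0 < d i) :
    (∀ s, arrivalExp s n y u d = 0) ∨
      ∃ T, IsLeast (hitTimes y u d) T ∧ T ≤ cycleStart u d n ∧
        ∀ s, arrivalExp s n y u d = ENNReal.ofReal (Real.exp (s * T)) := by
  induction n generalizing y u d with
  | zero => exact Or.inl fun s => rfl
  | succ n ih =>
    have hu0 := hu 0
    have hd0 := hd 0
    have hu' : ∀ i, 0 < shift u i := fun i => hu (i + 1)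
    have hd' : ∀ i, 0 < shift d i := fun i => hd (i + 1)
    by_cases h : y + u 0 ≤ d 0
    · right
      refine ⟨y + 2 * u 0, ⟨⟨by linarith, ?_⟩, ?_⟩, ?_, fun s => by simp [arrivalExp, h]⟩
      · rw [position_of_le_down hu hd _ (by linarith) (by linarith)]; ring
      · rintro t ⟨h0, ht⟩
        by_contra! hlt
        rcases le_total t (u 0) with h1 | h1
        · rw [position_of_le_up hu hd _ h0.le h1] at ht; linarith
        · rw [position_of_le_down hu hd _ h1 (by linarith)] at ht; linarith
      · have := cycleStart_monotone hu hd (show 1 ≤ n + 1 by omega)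
        simp only [cycleStart, Finset.range_one, Finset.sum_singleton] at this
        rw [cycleStart]; linarith
    · push Not at h
      rcases ih (y := y + u 0 - d 0) (by linarith) (u := shift u) (d := shift d)
        hu' hd' with h1 | ⟨T, ⟨⟨hT0, hT⟩, hTl⟩, hTn, hTs⟩
      · left
        intro s
        rw [arrivalExp, if_neg (not_le.2 h), h1, mul_zero]
      · right
        have hcs := cycleStart_succ_eq_add_shift u d n
        refine ⟨u 0 + d 0 + T, ⟨⟨by linarith, ?_⟩, ?_⟩, by linarith, fun s => ?_⟩
        · rw [position_eq_position_shift hu hd _ (n := n) (by linarith) (by linarith),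
            add_sub_cancel_left, hT]
        · rintro t ⟨h0, ht⟩
          by_contra! hlt
          rcases le_total t (u 0) with h1 | h1
          · rw [position_of_le_up hu hd _ h0.le h1] at ht; linarith
          rcases le_total t (u 0 + d 0) with h2 | h2
          · rw [position_of_le_down hu hd _ h1 h2] at ht; linarith
          · rw [position_eq_position_shift hu hd _ (n := n) h2 (by linarith)] at ht
            -- The end of the cycle is time `0` of the restarted motion, which `hitTimes` leaves
            -- out, so it is excluded separately: the position there is `y + u 0 - d 0 > 0`.
            rcases h2.eq_or_lt with h3 | h3
            · rw [← h3, sub_self, position_of_le_up hu' hd' _ le_rfl (hu' 0).le] at ht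
              linarith
            · have := hTl ⟨sub_pos.2 h3, ht⟩
              linarith
        · rw [arrivalExp, if_neg (not_le.2 h), hTs, ← ENNReal.ofReal_mul (Real.exp_nonneg _),
            ← Real.exp_add]
          ring_nf

/-- The case `s = 0` is the indicator of arrival within `n` cycles. Once it is nonzero, the sequence
is constant in `n` from there on, for every `s`. -/
lemma iSup_arrivalExp_eq {y : ℝ} (hy : 0 ≤ y) {u d : ℕ → ℝ} (hu : ∀ i, 0 < u i)
    (hd : ∀ i, 0 < d i) (h : ⨆ n, arrivalExp 0 n y u d ≠ 0) :
    (hitTimes y u d).Nonempty ∧ ∀ s,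
      ⨆ n, arrivalExp s n y u d = ENNReal.ofReal (Real.exp (s * firstArrival y u d)) := by
  obtain ⟨n, hn⟩ : ∃ n, arrivalExp 0 n y u d ≠ 0 := by
    by_contra! h'
    exact h (by simp [h'])
  have key : ∀ m, n ≤ m → ∀ s,
      arrivalExp s m y u d = ENNReal.ofReal (Real.exp (s * firstArrival y u d)) := by
    intro m hm s
    rcases arrivalExp_eq_zero_or m hy hu hd with h1 | ⟨T, hT, -, hTs⟩
    · exact absurd (le_antisymm ((arrivalExp_mono 0 y u d hm).trans_eq (h1 0)) bot_le) hn
    · rw [hTs, firstArrival, hT.csInf_eq]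
  refine ⟨?_, fun s => ?_⟩
  · rcases arrivalExp_eq_zero_or n hy hu hd with h1 | ⟨T, hT, -, -⟩
    · exact absurd (h1 0) hn
    · exact ⟨T, hT.1⟩
  · refine le_antisymm (iSup_le fun m => ?_) ((key n le_rfl s).ge.trans (le_iSup (fun n => arrivalExp s n y u d) n))
    rw [← key (max n m) (le_max_left _ _) s]
    exact arrivalExp_mono s y u d (le_max_right _ _)

lemma measurable_arrivalExp (s : ℝ) (n : ℕ) :
    Measurable fun p : ℝ × (ℕ → ℝ) × (ℕ → ℝ) => arrivalExp s n p.1 p.2.1 p.2.2 := by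
  induction n with
  | zero => exact measurable_const
  | succ n ih =>
    simp only [arrivalExp]
    refine Measurable.ite (measurableSet_le (by fun_prop) (by fun_prop)) (by fun_prop) ?_
    refine Measurable.mul (by fun_prop) ?_
    exact ih.comp (g := fun p : ℝ × (ℕ → ℝ) × (ℕ → ℝ) => arrivalExp s n p.1 p.2.1 p.2.2)
      (f := fun p : ℝ × (ℕ → ℝ) × (ℕ → ℝ) =>
        (p.1 + p.2.1 0 - p.2.2 0, shift p.2.1, shift p.2.2)) (by
          unfold shift; fun_prop)

/-! ### Independence of the first cycle and of the rest of the motion -/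

lemma indepFun_pi_of_disjoint {ι Ω β : Type*} [MeasurableSpace Ω] [MeasurableSpace β]
    {P : Measure Ω} {X : ι → Ω → β} (hX : ∀ i, Measurable (X i)) (h : iIndepFun X P)
    {S T : Set ι} (hST : Disjoint S T) :
    IndepFun (fun ω (i : S) => X i ω) (fun ω (i : T) => X i ω) P := by
  have := indep_iSup_of_disjoint (fun i => (hX i).comap_le) h.iIndep hST
  rw [IndepFun_iff_Indep]
  refine indep_of_indep_of_le_left (indep_of_indep_of_le_right this ?_) ?_
  all_goals
    rw [MeasurableSpace.pi, MeasurableSpace.comap_iSup, iSup_le_iff]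
    rintro ⟨i, hi⟩
    rw [MeasurableSpace.comap_comp]
    exact le_iSup₂_of_le i hi le_rfl

lemma indepFun_first_shift {Ω : Type*} [MeasurableSpace Ω] {P : Measure Ω} {U D : ℕ → Ω → ℝ}
    (hU : ∀ i, Measurable (U i)) (hD : ∀ i, Measurable (D i))
    (hind : iIndepFun (Sum.elim U D) P) :
    IndepFun (fun ω => (U 0 ω, D 0 ω))
      (fun ω => (shift (fun i => U i ω), shift (fun i => D i ω))) P := by
  have hX : ∀ i, Measurable (Sum.elim U D i) := by rintro (i | i) <;> simp [hU, hD]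
  have h := indepFun_pi_of_disjoint hX hind
    (S := {Sum.inl 0, Sum.inr 0}) (T := {Sum.inl 0, Sum.inr 0}ᶜ) disjoint_compl_right
  exact h.comp
    (φ := fun p : ({Sum.inl 0, Sum.inr 0} : Set (ℕ ⊕ ℕ)) → ℝ =>
      (p ⟨Sum.inl 0, by simp⟩, p ⟨Sum.inr 0, by simp⟩))
    (ψ := fun p : (({Sum.inl 0, Sum.inr 0}ᶜ : Set (ℕ ⊕ ℕ)) : Type) → ℝ =>
      ((fun i => p ⟨Sum.inl (i + 1), by simp⟩ : ℕ → ℝ),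
        (fun i => p ⟨Sum.inr (i + 1), by simp⟩ : ℕ → ℝ)))
    (by fun_prop) (by fun_prop)

lemma iIndepFun_sumElim_shift {Ω : Type*} [MeasurableSpace Ω] {P : Measure Ω} {U D : ℕ → Ω → ℝ}
    (hind : iIndepFun (Sum.elim U D) P) :
    iIndepFun (Sum.elim (fun i => U (i + 1)) (fun i => D (i + 1))) P := by
  have h := hind.precomp (g := Sum.map (· + 1) (· + 1))
    (Function.Injective.sumMap (add_left_injective 1) (add_left_injective 1))
  convert h using 1
  ext i
  rcases i with i | i <;> rfl

/-! ### The recursion over the cycles -/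

/-- The contribution of a first cycle with periods `a` and `b`, when `φ` is the value of the
motion that is restarted at the end of the cycle. -/
def cycleValue (s y : ℝ) (φ : ℝ → ℝ≥0∞) (a b : ℝ) : ℝ≥0∞ :=
  if y + a ≤ b then ENNReal.ofReal (Real.exp (s * (y + 2 * a)))
  else ENNReal.ofReal (Real.exp (s * (a + b))) * φ (y + a - b)

/-- The expectation of `arrivalExp`, given by the recursion over the cycles. -/
def meanArrivalExp (lam mu s : ℝ) : ℕ → ℝ → ℝ≥0∞
  | 0, _ => 0
  | n + 1, y =>
    ∫⁻ a, ∫⁻ b, cycleValue s y (meanArrivalExp lam mu s n) a b ∂expMeasure mu ∂expMeasure lam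

/-- The first cycle is independent of the later ones, which satisfy the same hypotheses; the
induction therefore runs over all `U` and `D`. -/
lemma lintegral_arrivalExp {Ω : Type*} [MeasurableSpace Ω] {P : Measure Ω}
    [IsProbabilityMeasure P] {lam mu : ℝ} (s : ℝ) (hlam : 0 < lam) (hmu : 0 < mu) (n : ℕ) (y : ℝ)
    {U D : ℕ → Ω → ℝ} (hU : ∀ i, Measurable (U i)) (hD : ∀ i, Measurable (D i))
    (hUl : ∀ i, P.map (U i) = expMeasure lam) (hDl : ∀ i, P.map (D i) = expMeasure mu)
    (hind : iIndepFun (Sum.elim U D) P) :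
    ∫⁻ ω, arrivalExp s n y (fun i => U i ω) (fun i => D i ω) ∂P = meanArrivalExp lam mu s n y := by
  have := isProbabilityMeasure_expMeasure hlam
  have := isProbabilityMeasure_expMeasure hmu
  induction n generalizing y U D with
  | zero => simp [arrivalExp, meanArrivalExp]
  | succ n ih =>
    have hsh : Measurable fun ω => (shift (fun i => U i ω), shift (fun i => D i ω)) := by
      unfold shift; fun_prop
    have hfst : Measurable fun ω => (U 0 ω, D 0 ω) := (hU 0).prodMk (hD 0)
    have hlaw : P.map (fun ω => (U 0 ω, D 0 ω)) = (expMeasure lam).prod (expMeasure mu) := by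
      rw [← hUl 0, ← hDl 0]
      exact (indepFun_iff_map_prod_eq_prod_map_map (hU 0).aemeasurable (hD 0).aemeasurable).1
        (hind.indepFun (i := Sum.inl 0) (j := Sum.inr 0) (by simp))
    have hjoint := (indepFun_iff_map_prod_eq_prod_map_map hfst.aemeasurable hsh.aemeasurable).1
      (indepFun_first_shift hU hD hind)
    rw [hlaw] at hjoint
    set Q := P.map (fun ω => (shift (fun i => U i ω), shift (fun i => D i ω))) with hQ
    have : IsProbabilityMeasure Q := Measure.isProbabilityMeasure_map hsh.aemeasurable
    let F : (ℝ × ℝ) × ((ℕ → ℝ) × (ℕ → ℝ)) → ℝ≥0∞ := fun p =>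
      cycleValue s y (fun z => arrivalExp s n z p.2.1 p.2.2) p.1.1 p.1.2
    have hF : Measurable F := by
      simp only [F, cycleValue]
      refine Measurable.ite (measurableSet_le (by fun_prop) (by fun_prop)) (by fun_prop) ?_
      refine Measurable.mul (by fun_prop) ?_
      exact (measurable_arrivalExp s n).comp
        (f := fun p : (ℝ × ℝ) × ((ℕ → ℝ) × (ℕ → ℝ)) => (y + p.1.1 - p.1.2, p.2.1, p.2.2))
        (by fun_prop)
    have hinner : ∀ q : ℝ × ℝ, ∫⁻ r, F (q, r) ∂Q =
        cycleValue s y (meanArrivalExp lam mu s n) q.1 q.2 := by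
      intro q
      simp only [F, cycleValue]
      split_ifs with hq
      · simp
      · have hm : Measurable fun r : (ℕ → ℝ) × (ℕ → ℝ) =>
            arrivalExp s n (y + q.1 - q.2) r.1 r.2 :=
          (measurable_arrivalExp s n).comp (f := fun r : (ℕ → ℝ) × (ℕ → ℝ) =>
            (y + q.1 - q.2, r.1, r.2)) (by fun_prop)
        rw [lintegral_const_mul _ hm, hQ, lintegral_map hm hsh]
        congr 1
        exact ih _ (fun i => hU _) (fun i => hD _) (fun i => hUl _) (fun i => hDl _)
          (iIndepFun_sumElim_shift hind)
    have h1 : ∫⁻ ω, arrivalExp s (n + 1) y (fun i => U i ω) (fun i => D i ω) ∂P =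
        ∫⁻ p, F p ∂(((expMeasure lam).prod (expMeasure mu)).prod Q) := by
      rw [← hjoint, lintegral_map hF (hfst.prodMk hsh)]
      rfl
    rw [h1, lintegral_prod _ hF.aemeasurable]
    have hmeas : Measurable fun q : ℝ × ℝ => ∫⁻ r, F (q, r) ∂Q := hF.lintegral_prod_right'
    rw [lintegral_prod _ hmeas.aemeasurable, meanArrivalExp]
    simp only [hinner]

/-! ### The fixed point of the recursion -/

lemma lintegral_expMeasure {r : ℝ} {f : ℝ → ℝ≥0∞} (hf : Measurable f) :
    ∫⁻ t, f t ∂expMeasure r = ∫⁻ t in Set.Ioi 0, ENNReal.ofReal (r * Real.exp (-(r * t))) * f t := by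
  have h : expMeasure r = volume.withDensity (exponentialPDF r) := rfl
  have hm : Measurable (exponentialPDF r) := (measurable_exponentialPDFReal r).ennreal_ofReal
  rw [h, lintegral_withDensity_eq_lintegral_mul _ hm hf, ← lintegral_indicator measurableSet_Ioi]
  refine lintegral_congr_ae ?_
  -- The density does not vanish at `0`, but `Set.Ioi 0` omits this point.
  filter_upwards [Measure.ae_ne volume (0 : ℝ)] with t ht
  rw [Pi.mul_apply, exponentialPDF_eq]
  rcases ht.lt_or_gt with h | h
  · simp [not_le.2 h, h.le]
  · simp [h.le, h]

lemma ae_pos_expMeasure {r : ℝ} : ∀ᵐ t ∂expMeasure r, 0 < t := by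
  have hs : MeasurableSet {t : ℝ | ¬ 0 < t} := by measurability
  rw [ae_iff, ← lintegral_indicator_one hs,
    lintegral_expMeasure (measurable_one.indicator hs),
    setLIntegral_congr_fun (g := fun _ => 0) measurableSet_Ioi, lintegral_zero]
  intro t ht
  simp [Set.mem_Ioi.1 ht]

lemma setLIntegral_exp_Ioi {c : ℝ} (hc : 0 < c) (v : ℝ) :
    ∫⁻ t in Set.Ioi v, ENNReal.ofReal (c * Real.exp (-(c * t))) =
      ENNReal.ofReal (Real.exp (-(c * v))) := by
  have hi : IntegrableOn (fun t => c * Real.exp (-(c * t))) (Set.Ioi v) := by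
    have := (exp_neg_integrableOn_Ioi v hc).const_mul c
    simp only [neg_mul] at this
    exact this
  rw [← ofReal_integral_eq_lintegral_ofReal hi (ae_of_all _ fun t => by positivity),
    integral_const_mul]
  have := integral_exp_mul_Ioi (a := -c) (by linarith) v
  simp only [neg_mul] at this
  rw [this]
  congr 1
  field_simp

lemma lintegral_exp_expMeasure {r c : ℝ} (hr : 0 < r) (hc : c < r) :
    ∫⁻ t, ENNReal.ofReal (Real.exp (c * t)) ∂expMeasure r = ENNReal.ofReal (r / (r - c)) := by
  have hrc : 0 < r - c := by linarith
  rw [lintegral_expMeasure (by fun_prop)]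
  have : ∀ t : ℝ, ENNReal.ofReal (r * Real.exp (-(r * t))) * ENNReal.ofReal (Real.exp (c * t)) =
      ENNReal.ofReal (r / (r - c)) * ENNReal.ofReal ((r - c) * Real.exp (-((r - c) * t))) := by
    intro t
    rw [← ENNReal.ofReal_mul (by positivity), ← ENNReal.ofReal_mul (by positivity), mul_assoc,
      ← Real.exp_add, ← mul_assoc, div_mul_cancel₀ _ hrc.ne']
    ring_nf
  simp only [this]
  rw [lintegral_const_mul _ (by fun_prop), setLIntegral_exp_Ioi hrc]
  simp

/-- Integration over the downward period of the first cycle. -/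
lemma lintegral_down {mu s psi G : ℝ} (hmu : 0 < mu) (hG : mu * G = mu - s + psi) (hG0 : 0 < G)
    {a y : ℝ} (hv : 0 ≤ y + a) :
    ∫⁻ b, cycleValue s y (fun z => ENNReal.ofReal (G * Real.exp (z * psi))) a b ∂expMeasure mu =
      ENNReal.ofReal (Real.exp (s * a + psi * (y + a))) := by
  set m := mu - s + psi with hm
  have hm0 : 0 < m := by rw [← hG]; positivity
  rw [lintegral_expMeasure (by
    unfold cycleValue
    exact Measurable.ite (measurableSet_le (by fun_prop) (by fun_prop)) (by fun_prop)
      (by fun_prop)), ← Set.Ioc_union_Ioi_eq_Ioi hv, lintegral_union measurableSet_Ioi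
      (Set.Ioc_disjoint_Ioi le_rfl)]
  -- After arrival (`h1`) and before it (`h2`) the integral is the same multiple of the exponential
  -- law of rate `m`. For `h1` this is a comparison of tails, for `h2` a pointwise identity using
  -- `mu * G = m`.
  have h1 : ∫⁻ t in Set.Ioi (y + a), ENNReal.ofReal (mu * Real.exp (-(mu * t))) *
      cycleValue s y (fun z => ENNReal.ofReal (G * Real.exp (z * psi))) a t =
      ENNReal.ofReal (Real.exp (s * a + psi * (y + a))) *
        ∫⁻ t in Set.Ioi (y + a), ENNReal.ofReal (m * Real.exp (-(m * t))) := by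
    rw [setLIntegral_congr_fun (g := fun t => ENNReal.ofReal (mu * Real.exp (-(mu * t))) *
      ENNReal.ofReal (Real.exp (s * (y + 2 * a)))) measurableSet_Ioi,
      lintegral_mul_const _ (by fun_prop), setLIntegral_exp_Ioi hmu, setLIntegral_exp_Ioi hm0,
      ← ENNReal.ofReal_mul (by positivity), ← ENNReal.ofReal_mul (by positivity),
      ← Real.exp_add, ← Real.exp_add, hm]
    · ring_nf
    · intro t ht
      simp only [cycleValue, if_pos (Set.mem_Ioi.1 ht).le]
  have h2 : ∫⁻ t in Set.Ioc 0 (y + a), ENNReal.ofReal (mu * Real.exp (-(mu * t))) *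
      cycleValue s y (fun z => ENNReal.ofReal (G * Real.exp (z * psi))) a t =
      ENNReal.ofReal (Real.exp (s * a + psi * (y + a))) *
        ∫⁻ t in Set.Ioc 0 (y + a), ENNReal.ofReal (m * Real.exp (-(m * t))) := by
    -- The endpoint `y + a` belongs to the arrival branch of `cycleValue` and is discarded as a null
    -- set.
    rw [← lintegral_const_mul _ (by fun_prop), Measure.restrict_congr_set Ioo_ae_eq_Ioc.symm]
    refine setLIntegral_congr_fun measurableSet_Ioo fun t ht => ?_
    simp only [cycleValue, if_neg (not_le.2 ht.2)]
    rw [← ENNReal.ofReal_mul (by positivity), ← ENNReal.ofReal_mul (by positivity),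
      ← ENNReal.ofReal_mul (by positivity)]
    congr 1
    calc _ = (mu * G) * (Real.exp (-(mu * t)) * (Real.exp (s * (a + t)) *
          Real.exp ((y + a - t) * psi))) := by ring
      _ = m * (Real.exp (s * a + psi * (y + a)) * Real.exp (-(m * t))) := by
        rw [hG, ← Real.exp_add, ← Real.exp_add, ← Real.exp_add, hm]; ring_nf
      _ = _ := by ring
  rw [h1, h2, ← mul_add, ← lintegral_union measurableSet_Ioi
      (Set.Ioc_disjoint_Ioi le_rfl), Set.Ioc_union_Ioi_eq_Ioi hv, setLIntegral_exp_Ioi hm0]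
  simp

lemma lintegral_cycleValue_fixed {lam mu s psi G : ℝ} (hmu : 0 < mu) (hlam : 0 < lam)
    (hG : mu * G = mu - s + psi) (hG' : G * (lam - s - psi) = lam) (hG0 : 0 < G)
    {y : ℝ} (hy : 0 ≤ y) :
    ∫⁻ a, ∫⁻ b, cycleValue s y (fun z => ENNReal.ofReal (G * Real.exp (z * psi))) a b
      ∂expMeasure mu ∂expMeasure lam = ENNReal.ofReal (G * Real.exp (y * psi)) := by
  have hpos : 0 < lam - s - psi := by
    by_contra! h
    nlinarith [mul_nonneg hG0.le (neg_nonneg.2 h)]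
  rw [lintegral_congr_ae (g := fun a => ENNReal.ofReal (Real.exp (y * psi)) *
    ENNReal.ofReal (Real.exp ((s + psi) * a))), lintegral_const_mul _ (by fun_prop),
    lintegral_exp_expMeasure hlam (by linarith), ← ENNReal.ofReal_mul (by positivity)]
  · congr 1
    rw [← eq_div_iff hpos.ne'] at hG'
    rw [hG', mul_comm, sub_sub]
  · filter_upwards [ae_pos_expMeasure (r := lam)] with a ha
    rw [lintegral_down hmu hG hG0 (by linarith), ← ENNReal.ofReal_mul (by positivity),
      ← Real.exp_add]
    ring_nf

/-- Without stopping at the origin, exponentials in `y` are eigenfunctions of the cycle operator.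
The eigenvalue is the ratio of the geometric error bound. -/
lemma lintegral_exp_cycle {lam mu s c : ℝ} (hmu : 0 < mu) (hlam : 0 < lam) (y : ℝ)
    (h1 : s + c < lam) (h2 : s - c < mu) :
    ∫⁻ a, ∫⁻ b, ENNReal.ofReal (Real.exp (s * (a + b))) *
        ENNReal.ofReal (Real.exp ((y + a - b) * c)) ∂expMeasure mu ∂expMeasure lam =
      ENNReal.ofReal (lam * mu / ((lam - s - c) * (mu - s + c)) * Real.exp (y * c)) := by
  have h : ∀ a b : ℝ, ENNReal.ofReal (Real.exp (s * (a + b))) *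
        ENNReal.ofReal (Real.exp ((y + a - b) * c)) =
      ENNReal.ofReal (Real.exp (y * c)) * ENNReal.ofReal (Real.exp ((s + c) * a)) *
        ENNReal.ofReal (Real.exp ((s - c) * b)) := by
    intro a b
    rw [← ENNReal.ofReal_mul (by positivity), ← ENNReal.ofReal_mul (by positivity),
      ← ENNReal.ofReal_mul (by positivity), ← Real.exp_add, ← Real.exp_add, ← Real.exp_add]
    ring_nf
  have h3 : 0 < lam - (s + c) := by linarith
  have h4 : 0 < mu - (s - c) := by linarith
  simp only [h]
  simp_rw [lintegral_const_mul _ (show Measurable fun b : ℝ =>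
    ENNReal.ofReal (Real.exp ((s - c) * b)) by fun_prop), lintegral_exp_expMeasure hmu h2]
  rw [lintegral_mul_const _ (by fun_prop), lintegral_const_mul _ (by fun_prop),
    lintegral_exp_expMeasure hlam h1, ← ENNReal.ofReal_mul (by positivity),
    ← ENNReal.ofReal_mul (by positivity)]
  congr 1
  rw [show lam - s - c = lam - (s + c) by ring, show mu - s + c = mu - (s - c) by ring]
  field_simp

section Fixed

variable {lam mu s psi G c : ℝ}

lemma meanArrivalExp_le (hmu : 0 < mu) (hlam : 0 < lam)
    (hG : mu * G = mu - s + psi) (hG' : G * (lam - s - psi) = lam) (hG0 : 0 < G)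
    (n : ℕ) {y : ℝ} (hy : 0 ≤ y) :
    meanArrivalExp lam mu s n y ≤ ENNReal.ofReal (G * Real.exp (y * psi)) := by
  induction n generalizing y with
  | zero => simp [meanArrivalExp]
  | succ n ih =>
    rw [meanArrivalExp, ← lintegral_cycleValue_fixed hmu hlam hG hG' hG0 hy]
    refine lintegral_mono fun a => lintegral_mono fun b => ?_
    simp only [cycleValue]
    split_ifs with h
    · exact le_rfl
    · exact mul_le_mul_right (ih (by linarith)) _

/-- The error comes only from paths that have not arrived in `n` cycles. Dropping the stopping
condition bounds it by `n` applications of the unstopped operator to `G * exp (y * c)`, which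
dominates the fixed point since `psi ≤ c` and `0 ≤ y`. -/
lemma le_meanArrivalExp_add (hmu : 0 < mu) (hlam : 0 < lam)
    (hG : mu * G = mu - s + psi) (hG' : G * (lam - s - psi) = lam) (hG0 : 0 < G)
    (h1 : s + c < lam) (h2 : s - c < mu) (hc : psi ≤ c)
    (n : ℕ) {y : ℝ} (hy : 0 ≤ y) :
    ENNReal.ofReal (G * Real.exp (y * psi)) ≤ meanArrivalExp lam mu s n y +
      ENNReal.ofReal (G * (lam * mu / ((lam - s - c) * (mu - s + c))) ^ n * Real.exp (y * c)) := by
  have h3 : 0 < lam - s - c := by linarith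
  have h4 : 0 < mu - s + c := by linarith
  set rho := lam * mu / ((lam - s - c) * (mu - s + c)) with hrho
  have hrho0 : 0 < rho := by positivity
  induction n generalizing y with
  | zero =>
    rw [pow_zero, mul_one]
    refine le_add_left (ENNReal.ofReal_le_ofReal ?_)
    gcongr
  | succ n ih =>
    have hmeas : Measurable fun p : ℝ × ℝ => ENNReal.ofReal (Real.exp (s * (p.1 + p.2))) *
        ENNReal.ofReal (Real.exp ((y + p.1 - p.2) * c)) := by fun_prop
    have := isProbabilityMeasure_expMeasure hmu
    have hin : ∀ a : ℝ, Measurable fun b : ℝ => ENNReal.ofReal (Real.exp (s * (a + b))) *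
        ENNReal.ofReal (Real.exp ((y + a - b) * c)) := by intro a; fun_prop
    have hout : Measurable fun a : ℝ => ∫⁻ b, ENNReal.ofReal (Real.exp (s * (a + b))) *
        ENNReal.ofReal (Real.exp ((y + a - b) * c)) ∂expMeasure mu := hmeas.lintegral_prod_right'
    calc ENNReal.ofReal (G * Real.exp (y * psi))
        = ∫⁻ a, ∫⁻ b, cycleValue s y (fun z => ENNReal.ofReal (G * Real.exp (z * psi))) a b
          ∂expMeasure mu ∂expMeasure lam :=
          (lintegral_cycleValue_fixed hmu hlam hG hG' hG0 hy).symm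
      _ ≤ ∫⁻ a, ∫⁻ b, (cycleValue s y (meanArrivalExp lam mu s n) a b +
            ENNReal.ofReal (G * rho ^ n) * (ENNReal.ofReal (Real.exp (s * (a + b))) *
              ENNReal.ofReal (Real.exp ((y + a - b) * c)))) ∂expMeasure mu ∂expMeasure lam := by
          refine lintegral_mono fun a => lintegral_mono fun b => ?_
          simp only [cycleValue]
          split_ifs with h
          · exact le_self_add
          · have hi := ih (y := y + a - b) (by linarith)
            rw [ENNReal.ofReal_mul (by positivity : 0 ≤ G * rho ^ n)] at hi
            refine (mul_le_mul_right hi _).trans (le_of_eq ?_)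
            ring
      _ = meanArrivalExp lam mu s (n + 1) y +
            ENNReal.ofReal (G * rho ^ n) * ∫⁻ a, ∫⁻ b, (ENNReal.ofReal (Real.exp (s * (a + b))) *
              ENNReal.ofReal (Real.exp ((y + a - b) * c))) ∂expMeasure mu ∂expMeasure lam := by
          rw [meanArrivalExp, ← lintegral_const_mul _ hout,
            ← lintegral_add_right _ (hout.const_mul _)]
          refine lintegral_congr fun a => ?_
          rw [← lintegral_const_mul _ (hin a), ← lintegral_add_right _ ((hin a).const_mul _)]
      _ = _ := by
          rw [lintegral_exp_cycle hmu hlam y h1 h2, ← ENNReal.ofReal_mul (by positivity), ← hrho]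
          congr 2
          ring

lemma iSup_meanArrivalExp (hmu : 0 < mu) (hlam : 0 < lam)
    (hG : mu * G = mu - s + psi) (hG' : G * (lam - s - psi) = lam) (hG0 : 0 < G)
    (h1 : s + c < lam) (h2 : s - c < mu) (hc : psi ≤ c)
    (hlt : lam * mu < (lam - s - c) * (mu - s + c)) {y : ℝ} (hy : 0 ≤ y) :
    ⨆ n, meanArrivalExp lam mu s n y = ENNReal.ofReal (G * Real.exp (y * psi)) := by
  refine le_antisymm (iSup_le fun n => meanArrivalExp_le hmu hlam hG hG' hG0 n hy) ?_
  have h3 : 0 < lam - s - c := by linarith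
  have h4 : 0 < mu - s + c := by linarith
  have hl : Tendsto (fun n : ℕ => (⨆ n, meanArrivalExp lam mu s n y) + ENNReal.ofReal
      (G * (lam * mu / ((lam - s - c) * (mu - s + c))) ^ n * Real.exp (y * c))) atTop
      (𝓝 ((⨆ n, meanArrivalExp lam mu s n y) + ENNReal.ofReal (G * 0 * Real.exp (y * c)))) := by
    refine tendsto_const_nhds.add (ENNReal.tendsto_ofReal ?_)
    refine ((tendsto_pow_atTop_nhds_zero_of_lt_one (by positivity) ?_).const_mul G).mul_const _
    rwa [div_lt_one (by positivity)]
  simp only [mul_zero, zero_mul, ENNReal.ofReal_zero, add_zero] at hl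
  refine ge_of_tendsto' hl fun n => ?_
  exact (le_meanArrivalExp_add hmu hlam hG hG' hG0 h1 h2 hc n hy).trans
    (add_le_add_left (le_iSup (fun n => meanArrivalExp lam mu s n y) n) _)

end Fixed

/-! ### The moment generating functions -/

/-- The discriminant that appears in the Laplace exponent of the descent time. -/
def disc (lam mu s : ℝ) : ℝ := (lam + mu - 2 * s) ^ 2 - 4 * lam * mu

/-- The moment generating function of the return time to the origin. -/
def returnMgf (lam mu s : ℝ) : ℝ := (lam + mu - 2 * s - √(disc lam mu s)) / (2 * mu)

section Algebra

variable {lam mu s : ℝ}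

lemma two_sqrt_mul_lt (hmu : 0 < mu) (hlam : 0 < lam) (hs : s < (√lam - √mu) ^ 2 / 2) :
    2 * (√lam * √mu) < lam + mu - 2 * s := by
  nlinarith [Real.sq_sqrt hmu.le, Real.sq_sqrt hlam.le]

lemma disc_eq (hmu : 0 < mu) (hlam : 0 < lam) :
    disc lam mu s = ((√lam - √mu) ^ 2 - 2 * s) * ((√lam + √mu) ^ 2 - 2 * s) := by
  have h1 := Real.sq_sqrt hmu.le
  have h2 := Real.sq_sqrt hlam.le
  rw [disc]
  nth_rewrite 1 [← h1, ← h2]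
  nth_rewrite 2 [← h1, ← h2]
  ring

lemma disc_pos (hmu : 0 < mu) (hlam : 0 < lam) (hs : s < (√lam - √mu) ^ 2 / 2) :
    0 < disc lam mu s := by
  rw [disc_eq hmu hlam]
  have := mul_pos (Real.sqrt_pos.2 hmu) (Real.sqrt_pos.2 hlam)
  exact mul_pos (by linarith) (by nlinarith)

lemma sqrt_disc_lt (hmu : 0 < mu) (hlam : 0 < lam) (hs : s < (√lam - √mu) ^ 2 / 2) :
    √(disc lam mu s) < lam + mu - 2 * s := by
  have := two_sqrt_mul_lt hmu hlam hs
  rw [Real.sqrt_lt' ((by positivity : (0 : ℝ) < 2 * (√lam * √mu)).trans this), disc]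
  linarith [mul_pos hlam hmu]

lemma returnMgf_pos (hmu : 0 < mu) (hlam : 0 < lam) (hs : s < (√lam - √mu) ^ 2 / 2) :
    0 < returnMgf lam mu s :=
  div_pos (sub_pos.2 (sqrt_disc_lt hmu hlam hs)) (by linarith)

end Algebra

section Motion

variable {Ω : Type*} [MeasurableSpace Ω] {P : Measure Ω} [IsProbabilityMeasure P]
  {lam mu : ℝ} {U D : ℕ → Ω → ℝ}

lemma lintegral_iSup_arrivalExp (hmu : 0 < mu) (hlam : 0 < lam)
    (hU : ∀ i, Measurable (U i)) (hD : ∀ i, Measurable (D i))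
    (hUl : ∀ i, P.map (U i) = expMeasure lam) (hDl : ∀ i, P.map (D i) = expMeasure mu)
    (hind : iIndepFun (Sum.elim U D) P) {y s : ℝ} (hy : 0 ≤ y)
    (hs : s < (√lam - √mu) ^ 2 / 2) :
    ∫⁻ ω, ⨆ n, arrivalExp s n y (fun i => U i ω) (fun i => D i ω) ∂P =
      ENNReal.ofReal (returnMgf lam mu s *
        Real.exp (y / 2 * (lam - mu - √(disc lam mu s)))) := by
  have hm : ∀ n, Measurable fun ω => arrivalExp s n y (fun i => U i ω) (fun i => D i ω) :=
    fun n => (measurable_arrivalExp s n).comp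
      (f := fun ω => (y, (fun i => U i ω), (fun i => D i ω))) (by fun_prop)
  rw [lintegral_iSup hm (fun m n h ω => arrivalExp_mono s y _ _ h)]
  simp only [lintegral_arrivalExp s hlam hmu _ y hU hD hUl hDl hind]
  have hR := Real.sq_sqrt (disc_pos hmu hlam hs).le
  have hRp := Real.sqrt_pos.2 (disc_pos hmu hlam hs)
  have hRl := sqrt_disc_lt hmu hlam hs
  set R := √(disc lam mu s) with hRdef
  rw [disc] at hR
  -- This `c` maximizes `(lam - s - c) * (mu - s + c)`, with maximum `(lam + mu - 2 * s) ^ 2 / 4`.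
  rw [iSup_meanArrivalExp (psi := (lam - mu - R) / 2) (G := returnMgf lam mu s)
    (c := (lam - mu) / 2) hmu hlam _ _ (returnMgf_pos hmu hlam hs) (by linarith) (by linarith)
    (by linarith) (by nlinarith) hy]
  · ring_nf
  · rw [returnMgf, ← hRdef]; field_simp; ring
  · rw [returnMgf, ← hRdef]; field_simp; linarith

/-- At `s = 0` the supremum is at most `1` and has integral `1`, so it equals `1` almost surely and
the origin is reached. -/
lemma arrivalTime_spec_of_measurable (hmu : 0 < mu) (hlam : mu < lam)
    (hU : ∀ i, Measurable (U i)) (hD : ∀ i, Measurable (D i))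
    (hUl : ∀ i, P.map (U i) = expMeasure lam) (hDl : ∀ i, P.map (D i) = expMeasure mu)
    (hind : iIndepFun (Sum.elim U D) P) {y : ℝ} (hy : 0 ≤ y) :
    (∀ᵐ ω ∂P, (hitTimes y (fun i => U i ω) (fun i => D i ω)).Nonempty) ∧
    ∀ s < (√lam - √mu) ^ 2 / 2,
      Integrable (fun ω => Real.exp (s * arrivalTime y U D ω)) P ∧
      mgf (arrivalTime y U D) P s =
        returnMgf lam mu s * Real.exp (y / 2 * (lam - mu - √(disc lam mu s))) := by
  have hlam0 : 0 < lam := hmu.trans hlam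
  have hs0 : (0 : ℝ) < (√lam - √mu) ^ 2 / 2 := by
    have := Real.sqrt_lt_sqrt hmu.le hlam
    have : 0 < √lam - √mu := by linarith
    positivity
  have hm : ∀ s, Measurable fun ω =>
      ⨆ n, arrivalExp s n y (fun i => U i ω) (fun i => D i ω) := fun s =>
    Measurable.iSup fun n => (measurable_arrivalExp s n).comp
      (f := fun ω => (y, (fun i => U i ω), (fun i => D i ω))) (by fun_prop)
  have hUpos : ∀ᵐ ω ∂P, ∀ i, 0 < U i ω := ae_all_iff.2 fun i => by
    have := ae_pos_expMeasure (r := lam)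
    rw [← hUl i] at this
    exact ae_of_ae_map (hU i).aemeasurable this
  have hDpos : ∀ᵐ ω ∂P, ∀ i, 0 < D i ω := ae_all_iff.2 fun i => by
    have := ae_pos_expMeasure (r := mu)
    rw [← hDl i] at this
    exact ae_of_ae_map (hD i).aemeasurable this
  have hle : ∀ᵐ ω ∂P, ⨆ n, arrivalExp 0 n y (fun i => U i ω) (fun i => D i ω) ≤ 1 := by
    filter_upwards [hUpos, hDpos] with ω h1 h2
    refine iSup_le fun n => ?_
    rcases arrivalExp_eq_zero_or n hy h1 h2 with h | ⟨T, -, -, h⟩ <;> simp [h]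
  have hone : ∫⁻ ω, ⨆ n, arrivalExp 0 n y (fun i => U i ω) (fun i => D i ω) ∂P = 1 := by
    rw [lintegral_iSup_arrivalExp hmu hlam0 hU hD hUl hDl hind hy hs0]
    -- The downward drift `mu < lam` fixes the sign of the root, so that the exponent vanishes at `s
    -- = 0`.
    have : √(disc lam mu 0) = lam - mu := by
      rw [disc, show (lam + mu - 2 * 0) ^ 2 - 4 * lam * mu = (lam - mu) ^ 2 by ring,
        Real.sqrt_sq (by linarith)]
    rw [returnMgf, this, sub_self, mul_zero (y / 2), Real.exp_zero, mul_one,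
      show lam + mu - 2 * 0 - (lam - mu) = 2 * mu by ring, div_self (by positivity),
      ENNReal.ofReal_one]
  have hne : ∀ᵐ ω ∂P, ⨆ n, arrivalExp 0 n y (fun i => U i ω) (fun i => D i ω) ≠ 0 := by
    have h1 : (fun ω => ⨆ n, arrivalExp 0 n y (fun i => U i ω) (fun i => D i ω)) =ᵐ[P] 1 :=
      ae_eq_of_ae_le_of_lintegral_le hle (by rw [hone]; simp) aemeasurable_one
        (by simp [hone])
    filter_upwards [h1] with ω h
    rw [h]; simp
  have hspec : ∀ᵐ ω ∂P, (hitTimes y (fun i => U i ω) (fun i => D i ω)).Nonempty ∧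
      ∀ s, ⨆ n, arrivalExp s n y (fun i => U i ω) (fun i => D i ω) =
        ENNReal.ofReal (Real.exp (s * arrivalTime y U D ω)) := by
    filter_upwards [hne, hUpos, hDpos] with ω h h1 h2
    exact iSup_arrivalExp_eq hy h1 h2 h
  refine ⟨hspec.mono fun ω h => h.1, fun s hs => ?_⟩
  have hexp : (fun ω => Real.exp (s * arrivalTime y U D ω)) =ᵐ[P]
      fun ω => (⨆ n, arrivalExp s n y (fun i => U i ω) (fun i => D i ω)).toReal := by
    filter_upwards [hspec] with ω h
    rw [h.2 s, ENNReal.toReal_ofReal (Real.exp_nonneg _)]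
  have hint := lintegral_iSup_arrivalExp hmu hlam0 hU hD hUl hDl hind hy hs
  constructor
  · refine (integrable_toReal_of_lintegral_ne_top (hm s).aemeasurable ?_).congr hexp.symm
    rw [hint]; exact ENNReal.ofReal_ne_top
  · rw [mgf, integral_congr_ae hexp, integral_toReal (hm s).aemeasurable
      (ae_lt_top (hm s) (by rw [hint]; exact ENNReal.ofReal_ne_top)), hint,
      ENNReal.toReal_ofReal]
    have := returnMgf_pos hmu hlam0 hs
    positivity

/-- `HasLaw` provides only almost everywhere measurability; measurable versions of the countably
many periods give almost surely the same path. -/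
lemma arrivalTime_spec (hmu : 0 < mu) (hlam : mu < lam)
    (hU : ∀ i, HasLaw (U i) (expMeasure lam) P) (hD : ∀ i, HasLaw (D i) (expMeasure mu) P)
    (hind : iIndepFun (Sum.elim U D) P) {y : ℝ} (hy : 0 ≤ y) :
    (∀ᵐ ω ∂P, (hitTimes y (fun i => U i ω) (fun i => D i ω)).Nonempty) ∧
    ∀ s < (√lam - √mu) ^ 2 / 2,
      Integrable (fun ω => Real.exp (s * arrivalTime y U D ω)) P ∧
      mgf (arrivalTime y U D) P s =
        returnMgf lam mu s * Real.exp (y / 2 * (lam - mu - √(disc lam mu s))) := by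
  let U' : ℕ → Ω → ℝ := fun i => (hU i).aemeasurable.mk
  let D' : ℕ → Ω → ℝ := fun i => (hD i).aemeasurable.mk
  have hUe : ∀ i, U i =ᵐ[P] U' i := fun i => (hU i).aemeasurable.ae_eq_mk
  have hDe : ∀ i, D i =ᵐ[P] D' i := fun i => (hD i).aemeasurable.ae_eq_mk
  have hind' : iIndepFun (Sum.elim U' D') P := by
    refine (iIndepFun_congr ?_).1 hind
    rintro (i | i)
    · exact hUe i
    · exact hDe i
  have hpath : ∀ᵐ ω ∂P, (fun i => U i ω) = (fun i => U' i ω) ∧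
      (fun i => D i ω) = (fun i => D' i ω) := by
    filter_upwards [ae_all_iff.2 hUe, ae_all_iff.2 hDe] with ω h1 h2
    exact ⟨funext h1, funext h2⟩
  obtain ⟨h1, h2⟩ := arrivalTime_spec_of_measurable hmu hlam (U := U') (D := D')
    (fun i => (hU i).aemeasurable.measurable_mk) (fun i => (hD i).aemeasurable.measurable_mk)
    (fun i => by rw [← Measure.map_congr (hUe i), (hU i).map_eq])
    (fun i => by rw [← Measure.map_congr (hDe i), (hD i).map_eq]) hind' hy
  have hC : arrivalTime y U D =ᵐ[P] arrivalTime y U' D' := by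
    filter_upwards [hpath] with ω h
    rw [arrivalTime, arrivalTime, h.1, h.2]
  constructor
  · filter_upwards [h1, hpath] with ω h h'
    rwa [h'.1, h'.2]
  · intro s hs
    obtain ⟨h3, h4⟩ := h2 s hs
    constructor
    · refine h3.congr ?_
      filter_upwards [hC] with ω h
      rw [h]
    · rw [← h4]
      exact mgf_congr hC

end Motion

/-! ### Power series expansions -/

/-- Exchange of the order of summation in a dominated double series. -/
lemma hasSum_tsum_comm {F B : ℕ → ℕ → ℝ} {N g : ℕ → ℝ} {S : ℝ} (hB : ∀ j h, ‖F j h‖ ≤ B j h)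
    (hN : ∀ j, HasSum (B j) (N j)) (hNs : Summable N) (hg : ∀ j, HasSum (F j) (g j))
    (hS : HasSum g S) :
    (∀ h, Summable fun j => F j h) ∧ HasSum (fun h => ∑' j, F j h) S := by
  have hBs : Summable (Function.uncurry B) := by
    refine (summable_prod_of_nonneg fun p => (norm_nonneg _).trans (hB p.1 p.2)).2
      ⟨fun j => (hN j).summable, ?_⟩
    simpa only [Function.uncurry, (hN _).tsum_eq] using hNs
  have hF : Summable (Function.uncurry F) :=
    Summable.of_norm_bounded hBs fun p => hB p.1 p.2
  have hcol : ∀ h, Summable fun j => F j h := fun h => hF.prod_symm.prod_factor h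
  refine ⟨hcol, ?_⟩
  have hF' : HasSum (Function.uncurry F) S := by
    rw [hS.unique (hF.hasSum.prod_fiberwise hg)]
    exact hF.hasSum
  have hsw : HasSum (fun p : ℕ × ℕ => F p.2 p.1) S :=
    (Equiv.prodComm ℕ ℕ).hasSum_iff.2 hF'
  exact hsw.prod_fiberwise fun h => (hcol h).hasSum

/-! #### The Catalan generating function -/

/-- A telescoping sum at the radius of convergence. The resulting bound `2` selects the branch of
the square root in `hasSum_catalan`. -/
lemma sum_catalan_div_four_pow (n : ℕ) :
    ∑ k ∈ Finset.range n, (catalan k : ℝ) * (1 / 4) ^ k =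
      2 * (1 - (n.centralBinom : ℝ) * (1 / 4) ^ n) := by
  induction n with
  | zero => simp
  | succ n ih =>
    have h1 : ((n : ℝ) + 1) * catalan n = n.centralBinom := by
      exact_mod_cast succ_mul_catalan_eq_centralBinom n
    have h2 : ((n : ℝ) + 1) * (n + 1).centralBinom = 2 * (2 * n + 1) * n.centralBinom := by
      exact_mod_cast Nat.succ_mul_centralBinom_succ n
    have h3 : (0 : ℝ) < n + 1 := by positivity
    rw [Finset.sum_range_succ, ih, ← h1]
    rw [← h1] at h2
    have h4 : ((n + 1).centralBinom : ℝ) = 2 * (2 * n + 1) * catalan n := by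
      apply mul_left_cancel₀ h3.ne'
      rw [h2]; ring
    rw [h4, pow_succ]
    ring

lemma summable_catalan_div_four_pow : Summable fun k => (catalan k : ℝ) * (1 / 4) ^ k := by
  refine summable_of_sum_range_le (c := 2) (fun k => by positivity) fun n => ?_
  rw [sum_catalan_div_four_pow]
  have : (0 : ℝ) ≤ (n.centralBinom : ℝ) * (1 / 4) ^ n := by positivity
  linarith

lemma tsum_catalan_div_four_pow_le : ∑' k, (catalan k : ℝ) * (1 / 4) ^ k ≤ 2 := by
  refine Real.tsum_le_of_sum_range_le (fun k => by positivity) fun n => ?_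
  rw [sum_catalan_div_four_pow]
  have : (0 : ℝ) ≤ (n.centralBinom : ℝ) * (1 / 4) ^ n := by positivity
  linarith

lemma hasSum_catalan {q : ℝ} (hq : 0 < q) (hq' : q ≤ 1 / 4) :
    HasSum (fun k => (catalan k : ℝ) * q ^ k) ((1 - √(1 - 4 * q)) / (2 * q)) := by
  have hle : ∀ k : ℕ, (catalan k : ℝ) * q ^ k ≤ (catalan k : ℝ) * (1 / 4) ^ k := fun k => by
    gcongr
  have hs : Summable fun k => (catalan k : ℝ) * q ^ k :=
    summable_catalan_div_four_pow.of_nonneg_of_le (fun k => by positivity) hle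
  have hC2 : ∑' k, (catalan k : ℝ) * q ^ k ≤ 2 :=
    (hs.tsum_le_tsum hle summable_catalan_div_four_pow).trans tsum_catalan_div_four_pow_le
  have hquad : ∑' k, (catalan k : ℝ) * q ^ k = 1 + q * (∑' k, (catalan k : ℝ) * q ^ k) ^ 2 := by
    rw [sq, tsum_mul_tsum_eq_tsum_sum_antidiagonal_of_summable_norm hs.norm hs.norm,
      hs.tsum_eq_zero_add, ← tsum_mul_left]
    congr 1
    · simp
    · refine tsum_congr fun n => ?_
      rw [catalan_succ', Nat.cast_sum, Finset.sum_mul, Finset.mul_sum]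
      refine Finset.sum_congr rfl fun p hp => ?_
      rw [← Finset.HasAntidiagonal.mem_antidiagonal.1 hp]
      push_cast
      ring
  have h := hs.hasSum
  set C := ∑' k, (catalan k : ℝ) * q ^ k with hC
  have h1 : √(1 - 4 * q) = 1 - 2 * q * C := by
    -- Since `C ≤ 2` and `q ≤ 1 / 4`, the candidate root `1 - 2 * q * C` is nonnegative.
    rw [Real.sqrt_eq_iff_mul_self_eq (by linarith) (by nlinarith)]
    linear_combination (4 * q) * hquad
  rw [h1, show (1 - (1 - 2 * q * C)) / (2 * q) = C by field_simp; ring]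
  exact h

/-- Expansion of the moment generating function of the return time. -/
lemma hasSum_returnMgf {lam mu s : ℝ} (hmu : 0 < mu) (hlam : mu < lam)
    (hs : |s| < (√lam - √mu) ^ 2 / 2) :
    HasSum (fun m : ℕ => lam / (lam + mu) * (2 / (lam + mu)) ^ m *
        (∑' k : ℕ, (catalan k : ℝ) * ((m + 2 * k).choose (2 * k)) *
          (lam * mu / (lam + mu) ^ 2) ^ k) * s ^ m) (returnMgf lam mu s) := by
  have hlam0 : 0 < lam := hmu.trans hlam
  set L := lam + mu with hL
  have hL0 : 0 < L := by positivity
  have hpos : ∀ t, t < (√lam - √mu) ^ 2 / 2 → 0 < L - 2 * t := fun t ht =>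
    (Real.sqrt_nonneg _).trans_lt (sqrt_disc_lt hmu hlam0 ht)
  -- Negative binomial expansion of `(L - 2 * t) ^ (-(2 * k + 1))`. It is used at `t = s` for the
  -- values and at `t = |s|` for the majorant.
  have hgen : ∀ t, 2 * |t| < L → 0 < L - 2 * t → ∀ k : ℕ,
      HasSum (fun m : ℕ => (catalan k : ℝ) * ((m + 2 * k).choose (2 * k)) *
        (lam * mu / L ^ 2) ^ k * (lam / L * (2 * t / L) ^ m))
        (lam / (L - 2 * t) * ((catalan k : ℝ) * (lam * mu / (L - 2 * t) ^ 2) ^ k)) := by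
    intro t ht htp k
    have h := (hasSum_choose_mul_geometric_of_norm_lt_one (2 * k) (r := 2 * t / L) (by
      rw [Real.norm_eq_abs, abs_div, abs_mul, abs_of_pos hL0, abs_two, div_lt_one hL0]
      exact ht)).mul_left
      ((catalan k : ℝ) * (lam * mu / L ^ 2) ^ k * (lam / L))
    have hval : (catalan k : ℝ) * (lam * mu / L ^ 2) ^ k * (lam / L) *
        (1 / (1 - 2 * t / L) ^ (2 * k + 1)) =
        lam / (L - 2 * t) * ((catalan k : ℝ) * (lam * mu / (L - 2 * t) ^ 2) ^ k) := by
      have : 1 - 2 * t / L = (L - 2 * t) / L := by field_simp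
      rw [this, div_pow, div_pow, div_pow, pow_succ _ (2 * k), pow_succ _ (2 * k), ← pow_mul,
        ← pow_mul]
      field_simp
    rw [hval] at h
    refine h.congr_fun fun m => ?_
    ring
  have hsL : 2 * |s| < L := by linarith [hpos _ hs]
  have hsum : ∀ t, t < (√lam - √mu) ^ 2 / 2 →
      HasSum (fun k : ℕ => lam / (L - 2 * t) *
        ((catalan k : ℝ) * (lam * mu / (L - 2 * t) ^ 2) ^ k)) (returnMgf lam mu t) := by
    intro t ht
    have hw := hpos t ht
    have hd := disc_pos hmu hlam0 ht
    have h := (hasSum_catalan (q := lam * mu / (L - 2 * t) ^ 2) (by positivity) (by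
      rw [div_le_iff₀ (by positivity)]
      rw [disc] at hd
      linarith)).mul_left (lam / (L - 2 * t))
    have h1 : 1 - 4 * (lam * mu / (L - 2 * t) ^ 2) = disc lam mu t / (L - 2 * t) ^ 2 := by
      rw [disc, ← hL]; field_simp
    have h2 : lam / (L - 2 * t) * ((1 - √(1 - 4 * (lam * mu / (L - 2 * t) ^ 2))) /
        (2 * (lam * mu / (L - 2 * t) ^ 2))) = returnMgf lam mu t := by
      rw [h1, Real.sqrt_div hd.le, Real.sqrt_sq hw.le, returnMgf, ← hL]
      field_simp
    rwa [h2] at h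
  have hslt : s < (√lam - √mu) ^ 2 / 2 := (le_abs_self s).trans_lt hs
  have := (hasSum_tsum_comm (F := fun k m : ℕ => (catalan k : ℝ) * ((m + 2 * k).choose (2 * k)) *
        (lam * mu / L ^ 2) ^ k * (lam / L * (2 * s / L) ^ m))
      (B := fun k m : ℕ => (catalan k : ℝ) * ((m + 2 * k).choose (2 * k)) *
        (lam * mu / L ^ 2) ^ k * (lam / L * (2 * |s| / L) ^ m))
      (fun k m => le_of_eq (by
        rw [norm_mul, norm_mul (lam / L), norm_pow, norm_div (2 * s), norm_mul 2 s,
          Real.norm_eq_abs s, Real.norm_of_nonneg (by positivity),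
          Real.norm_of_nonneg (by positivity : 0 ≤ lam / L),
          Real.norm_of_nonneg hL0.le, Real.norm_two]))
      (fun k => hgen |s| (by rwa [abs_abs]) (hpos _ hs) k) (hsum _ hs).summable
      (fun k => hgen s hsL (hpos s hslt) k) (hsum s hslt)).2
  refine this.congr_fun fun m => ?_
  rw [tsum_mul_right, mul_div_right_comm 2 s L, mul_pow (2 / L)]
  ring

/-! #### Binomial series -/

lemma hasSum_gbinom (a : ℝ) {t : ℝ} (ht : |t| < 1) :
    HasSum (fun k => gbinom a k * t ^ k) ((1 + t) ^ a) := by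
  have h := (Real.one_add_rpow_hasFPowerSeriesOnBall_zero (a := a)).hasSum (y := t)
    (by simpa [enorm_eq_nnnorm, ← NNReal.coe_lt_coe] using ht)
  rw [zero_add] at h
  refine h.congr_fun fun k => ?_
  rw [binomialSeries, FormalMultilinearSeries.ofScalars_apply_eq, smul_eq_mul, gbinom,
    ← descPochhammer_eval_eq_prod_range, Ring.choose_eq_smul, ← Polynomial.aeval_eq_smeval,
    smul_eq_mul, div_eq_inv_mul]
  congr 2
  rw [← descPochhammer_map (Int.castRingHom ℝ), Polynomial.eval_map, Polynomial.aeval_def]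
  rfl

lemma gbinom_neg_mul (a : ℝ) (k : ℕ) :
    (-1) ^ k * gbinom (-a) k = (∏ i ∈ Finset.range k, (a + i)) / k.factorial := by
  rw [gbinom, mul_div_assoc', ← Finset.card_range k, ← Finset.prod_const, Finset.card_range,
    ← Finset.prod_mul_distrib]
  congr 1
  exact Finset.prod_congr rfl fun i _ => by ring

/-- Each factor satisfies `|a - i| ≤ a + i`, so the series of `(1 + t) ^ a` is dominated by that of
`(1 - |t|) ^ (-a)`. -/
lemma abs_gbinom_le {a : ℝ} (ha : 0 ≤ a) (k : ℕ) :
    |gbinom a k| ≤ (-1) ^ k * gbinom (-a) k := by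
  rw [gbinom_neg_mul, gbinom, abs_div, Nat.abs_cast, Finset.abs_prod]
  gcongr with i hi
  exact (abs_sub _ _).trans (by rw [abs_of_nonneg ha, Nat.abs_cast])

/-- The coefficient of `t ^ h` in `(1 + t) ^ a * (1 + z * t) ^ a`. -/
def binomConv (h : ℕ) (z a : ℝ) : ℝ :=
  ∑ k ∈ Finset.range (h + 1), gbinom a k * gbinom a (h - k) * z ^ k

lemma hasSum_binomConv (a z : ℝ) {t : ℝ} (ht : |t| < 1) (hzt : |z * t| < 1) :
    HasSum (fun h => binomConv h z a * t ^ h) ((1 + t) ^ a * (1 + z * t) ^ a) := by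
  have h1 := hasSum_gbinom a ht
  have h2 := hasSum_gbinom a hzt
  have h := hasSum_sum_range_mul_of_summable_norm h2.summable.norm h1.summable.norm
  rw [h1.tsum_eq, h2.tsum_eq, mul_comm ((1 + z * t) ^ a)] at h
  refine h.congr_fun fun n => ?_
  rw [binomConv, Finset.sum_mul]
  refine Finset.sum_congr rfl fun k hk => ?_
  have : t ^ n = t ^ k * t ^ (n - k) := by
    rw [← pow_add, Nat.add_sub_cancel' (Nat.lt_succ_iff.1 (Finset.mem_range.1 hk))]
  rw [this, mul_pow]
  ring

lemma norm_binomConv_mul_pow_le {a z : ℝ} (ha : 0 ≤ a) (hz : 0 ≤ z) (t : ℝ) (h : ℕ) :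
    ‖binomConv h z a * t ^ h‖ ≤ binomConv h z (-a) * (-|t|) ^ h := by
  rw [Real.norm_eq_abs, abs_mul, abs_pow, neg_eq_neg_one_mul |t|, mul_pow, ← mul_assoc]
  gcongr
  rw [binomConv, binomConv, Finset.sum_mul]
  refine (Finset.abs_sum_le_sum_abs _ _).trans (Finset.sum_le_sum fun k hk => ?_)
  have : (-1 : ℝ) ^ h = (-1) ^ k * (-1) ^ (h - k) := by
    rw [← pow_add, Nat.add_sub_cancel' (Nat.lt_succ_iff.1 (Finset.mem_range.1 hk))]
  rw [abs_mul, abs_mul, abs_of_nonneg (pow_nonneg hz k), this]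
  calc |gbinom a k| * |gbinom a (h - k)| * z ^ k
      ≤ ((-1) ^ k * gbinom (-a) k) * ((-1) ^ (h - k) * gbinom (-a) (h - k)) * z ^ k := by
        gcongr
        · exact (abs_nonneg _).trans (abs_gbinom_le ha k)
        · exact abs_gbinom_le ha k
        · exact abs_gbinom_le ha _
    _ = _ := by ring

lemma rpow_half_mul_rpow_half {a b : ℝ} (ha : 0 ≤ a) (hb : 0 ≤ b) (j : ℕ) :
    a ^ ((j : ℝ) / 2) * b ^ ((j : ℝ) / 2) = √(a * b) ^ j := by
  rw [← Real.mul_rpow ha hb, Real.sqrt_eq_rpow, ← Real.rpow_mul_natCast (mul_nonneg ha hb)]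
  congr 1
  ring

/-- Expansion of `exp (-κ √((1 + t) (1 + z t)))` in powers of `t`. -/
lemma hasSum_exp_neg_sqrt {z t : ℝ} (kappa : ℝ) (hz : 0 ≤ z) (hz1 : z ≤ 1) (ht : |t| < 1) :
    (∀ h, Summable fun j : ℕ =>
        (-kappa) ^ j * (1 / (j.factorial : ℝ)) * (binomConv h z ((j : ℝ) / 2) * t ^ h)) ∧
      HasSum (fun h => ∑' j : ℕ,
        (-kappa) ^ j * (1 / (j.factorial : ℝ)) * (binomConv h z ((j : ℝ) / 2) * t ^ h))
        (Real.exp (-kappa * √((1 + t) * (1 + z * t)))) := by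
  have hzt : ∀ u : ℝ, |u| < 1 → |z * u| < 1 := fun u hu => by
    rw [abs_mul, abs_of_nonneg hz]
    exact (mul_le_of_le_one_left (abs_nonneg _) hz1).trans_lt hu
  have hpos : ∀ u : ℝ, |u| < 1 → 0 < 1 + u := fun u hu => by linarith [(abs_lt.1 hu).1]
  have ht' : |(-|t|)| < 1 := by rwa [abs_neg, abs_abs]
  have hexp : ∀ c : ℝ, HasSum (fun j : ℕ => c ^ j * (1 / (j.factorial : ℝ))) (Real.exp c) := by
    intro c
    have := NormedSpace.expSeries_div_hasSum_exp c
    rw [← Real.exp_eq_exp_ℝ] at this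
    simpa only [mul_one_div] using this
  -- The majorant sums over `h` to the reciprocal of a `j`-th power, and then over `j` to an
  -- exponential.
  refine hasSum_tsum_comm
    (B := fun j h => |kappa| ^ j * (1 / (j.factorial : ℝ)) *
      (binomConv h z (-((j : ℝ) / 2)) * (-|t|) ^ h))
    (N := fun j => |kappa| ^ j * (1 / (j.factorial : ℝ)) *
      (√((1 + -|t|) * (1 + z * -|t|)) ^ j)⁻¹)
    (g := fun j => (-kappa) ^ j * (1 / (j.factorial : ℝ)) * √((1 + t) * (1 + z * t)) ^ j)
    (fun j h => ?_) (fun j => ?_) ?_ (fun j => ?_) ?_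
  · rw [norm_mul, norm_mul ((-kappa) ^ j), norm_pow, norm_neg, Real.norm_eq_abs kappa,
      Real.norm_of_nonneg (by positivity : (0 : ℝ) ≤ 1 / (j.factorial : ℝ))]
    gcongr
    exact norm_binomConv_mul_pow_le (by positivity) hz t h
  · refine HasSum.mul_left _ ?_
    have h := hasSum_binomConv (-((j : ℝ) / 2)) z ht' (hzt _ ht')
    rwa [Real.rpow_neg (hpos _ ht').le, Real.rpow_neg (hpos _ (hzt _ ht')).le, ← mul_inv,
      rpow_half_mul_rpow_half (hpos _ ht').le (hpos _ (hzt _ ht')).le] at h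
  · refine (hexp (|kappa| * (√((1 + -|t|) * (1 + z * -|t|)))⁻¹)).summable.congr fun j => ?_
    rw [mul_pow, inv_pow]
    ring
  · refine HasSum.mul_left _ ?_
    have h := hasSum_binomConv ((j : ℝ) / 2) z ht (hzt _ ht)
    rwa [rpow_half_mul_rpow_half (hpos _ ht).le (hpos _ (hzt _ ht)).le] at h
  · convert hexp (-kappa * √((1 + t) * (1 + z * t))) using 2 with j
    rw [mul_pow]
    ring

/-! ### The hypergeometric values -/

lemma gbinom_succ_mul (a : ℝ) (k : ℕ) : gbinom a (k + 1) * (k + 1) = gbinom a k * (a - k) := by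
  rw [gbinom, gbinom, Finset.prod_range_succ, Nat.factorial_succ]
  have : ((k : ℝ) + 1) ≠ 0 := by positivity
  push_cast
  field_simp

/-- The termwise identity between `binomHypRaw` and `binomConv`, cleared of denominators so that the
induction on `k` needs no condition on `a`. -/
lemma gbinom_mul_ascPochhammer (a : ℝ) {h k : ℕ} (hk : k ≤ h) :
    gbinom a h * (ascPochhammer ℝ k).eval (-(h : ℝ)) * (ascPochhammer ℝ k).eval (-a) =
      gbinom a k * k.factorial * gbinom a (h - k) * (ascPochhammer ℝ k).eval (a + 1 - h) := by
  induction k with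
  | zero => simp [gbinom]
  | succ k ih =>
    obtain ⟨m, rfl⟩ : ∃ m, h = k + 1 + m := Nat.exists_eq_add_of_le hk
    have ih := ih (by omega)
    have h1 := gbinom_succ_mul a k
    have h2 := gbinom_succ_mul a m
    rw [show k + 1 + m - k = m + 1 by omega] at ih
    rw [show k + 1 + m - (k + 1) = m by omega]
    simp only [ascPochhammer_succ_eval, Nat.factorial_succ]
    push_cast at ih ⊢
    set A := (ascPochhammer ℝ k).eval (a + 1 - (k + 1 + m))
    linear_combination ((m : ℝ) + 1) * (a - k) * ih +
      gbinom a k * k.factorial * A * (a - k) * h2 - k.factorial * gbinom a m * A * (a - m) * h1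

lemma binomHypRaw_eq {h : ℕ} {z a : ℝ} (ha : ∀ k : ℕ, a + 1 - h ≠ -(k : ℝ)) :
    binomHypRaw h z a = binomConv h z a := by
  rw [binomHypRaw, ordinaryHypergeometric, ordinaryHypergeometric_sum_eq,
    tsum_eq_sum (s := Finset.range (h + 1)), Finset.mul_sum, binomConv]
  · refine Finset.sum_congr rfl fun k hk => ?_
    have hne : (ascPochhammer ℝ k).eval (a + 1 - h) ≠ 0 := by
      rw [Ne, ascPochhammer_eval_eq_zero_iff]
      rintro ⟨i, -, hi⟩
      exact ha i (by linarith)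
    have := gbinom_mul_ascPochhammer a (Nat.lt_succ_iff.1 (Finset.mem_range.1 hk))
    have hk0 : (k.factorial : ℝ) ≠ 0 := by positivity
    rw [smul_eq_mul]
    field_simp
    linear_combination z ^ k * this
  · intro k hk
    rw [ascPochhammer_eval_neg_coe_nat_of_lt (by simpa using hk)]
    simp

lemma continuous_binomConv (h : ℕ) (z : ℝ) : Continuous (binomConv h z) := by
  unfold binomConv gbinom
  fun_prop

lemma tendsto_binomHypRaw (h j : ℕ) (z : ℝ) :
    Tendsto (binomHypRaw h z) (𝓝[≠] ((j : ℝ) / 2)) (𝓝 (binomConv h z ((j : ℝ) / 2))) := by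
  refine (((continuous_binomConv h z).tendsto _).mono_left nhdsWithin_le_nhds).congr' ?_
  -- At a pole `2 * a` is an integer. Within distance `1 / 2` of `j / 2` this forces `2 * a = j`,
  -- and that point is removed.
  have h1 : ∀ᶠ a in 𝓝[≠] ((j : ℝ) / 2), a ∈ Set.Ioo ((j : ℝ) / 2 - 1 / 2) ((j : ℝ) / 2 + 1 / 2) :=
    nhdsWithin_le_nhds (Ioo_mem_nhds (by linarith) (by linarith))
  filter_upwards [h1, self_mem_nhdsWithin] with a ha ha'
  refine (binomHypRaw_eq fun k hk => ha' ?_).symm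
  have e : 2 * a = ((2 * h - 2 - 2 * k : ℤ) : ℝ) := by push_cast; linarith
  have l1 : (j : ℤ) - 1 < 2 * h - 2 - 2 * k := by
    have : ((j - 1 : ℤ) : ℝ) < ((2 * h - 2 - 2 * k : ℤ) : ℝ) := by
      rw [← e]; push_cast; linarith [ha.1]
    exact_mod_cast this
  have l2 : 2 * (h : ℤ) - 2 - 2 * k < j + 1 := by
    have : ((2 * h - 2 - 2 * k : ℤ) : ℝ) < ((j + 1 : ℤ) : ℝ) := by
      rw [← e]; push_cast; linarith [ha.2]
    exact_mod_cast this
  have l3 : 2 * (h : ℤ) - 2 - 2 * k = j := by omega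
  rw [l3] at e
  rw [Set.mem_singleton_iff]
  push_cast at e
  linarith

lemma binomHyp_eq (h j : ℕ) (z : ℝ) :
    binomHyp h z ((j : ℝ) / 2) = binomConv h z ((j : ℝ) / 2) := by
  rw [binomHyp]
  split_ifs with hk
  · exact (tendsto_binomHypRaw h j z).limUnder_eq
  · push Not at hk
    exact binomHypRaw_eq hk

/-- The duplication formula: the step from `k` to `k + 1` contributes the two factors `m + 2 * k +
1` and `m + 2 * k + 2`. -/
lemma ascPochhammer_half_mul (m k : ℕ) :
    (ascPochhammer ℝ k).eval ((1 + m : ℝ) / 2) * (ascPochhammer ℝ k).eval ((2 + m : ℝ) / 2) *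
      4 ^ k * m.factorial = ((m + 2 * k).factorial : ℝ) := by
  induction k with
  | zero => simp
  | succ k ih =>
    rw [show m + 2 * (k + 1) = m + 2 * k + 1 + 1 by ring, Nat.factorial_succ, Nat.factorial_succ,
      ascPochhammer_succ_eval, ascPochhammer_succ_eval, pow_succ]
    push_cast
    rw [← ih]
    ring

lemma ascPochhammer_two (k : ℕ) :
    (ascPochhammer ℝ k).eval 2 = ((k + 1).factorial : ℝ) := by
  induction k with
  | zero => simp
  | succ k ih =>
    rw [ascPochhammer_succ_eval, ih, Nat.factorial_succ (k + 1)]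
    push_cast
    ring

lemma catalan_mul_factorial (k : ℕ) :
    (catalan k : ℝ) * (k.factorial * (k + 1).factorial) = ((2 * k).factorial : ℝ) := by
  have h1 := succ_mul_catalan_eq_centralBinom k
  have h2 := Nat.add_choose_mul_factorial_mul_factorial k k
  rw [← two_mul, ← Nat.centralBinom_eq_two_mul_choose, ← h1] at h2
  rw [← h2, Nat.factorial_succ]
  push_cast
  ring

lemma ordinaryHypergeometric_eq_tsum_catalan (m : ℕ) (q : ℝ) :
    ₂F₁ ((1 + m : ℝ) / 2) ((2 + m : ℝ) / 2) (2 : ℝ) (4 * q) =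
      ∑' k : ℕ, (catalan k : ℝ) * ((m + 2 * k).choose (2 * k)) * q ^ k := by
  rw [ordinaryHypergeometric_eq_tsum]
  refine tsum_congr fun k => ?_
  have h1 := ascPochhammer_half_mul m k
  have h2 := catalan_mul_factorial k
  have h3 : (((m + 2 * k).choose (2 * k) : ℕ) : ℝ) * m.factorial * (2 * k).factorial =
      (m + 2 * k).factorial := by
    have := Nat.add_choose_mul_factorial_mul_factorial m (2 * k)
    exact_mod_cast this
  have hm : (m.factorial : ℝ) ≠ 0 := by positivity
  have hk : (k.factorial : ℝ) ≠ 0 := by positivity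
  have hk' : ((k + 1).factorial : ℝ) ≠ 0 := by positivity
  rw [ascPochhammer_two, smul_eq_mul, mul_pow]
  field_simp
  apply mul_right_cancel₀ hm
  rw [← h2, ← h1] at h3
  linear_combination (-q ^ k) * h3

/-! ### The moments -/

section Moments

variable {lam mu : ℝ}

lemma momentTerm_mul_pow (x t : ℝ) (h j : ℕ) :
    momentTerm lam mu x h j * t ^ h = (-((lam - mu) * x / 2)) ^ j * (1 / (j.factorial : ℝ)) *
      (binomConv h (((√lam - √mu) / (√lam + √mu)) ^ 2) ((j : ℝ) / 2) * t ^ h) := by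
  rw [momentTerm, binomHyp_eq, mul_assoc]

lemma sqrt_ratio_sq_le_one (hmu : 0 < mu) (hlam : mu < lam) :
    ((√lam - √mu) / (√lam + √mu)) ^ 2 ≤ 1 := by
  have h1 := Real.sqrt_pos.2 hmu
  have h2 := Real.sqrt_lt_sqrt hmu.le hlam
  refine pow_le_one₀ (div_nonneg (by linarith) (by linarith)) ?_
  rw [div_le_one (by linarith)]
  linarith

lemma summable_momentTerm (hmu : 0 < mu) (hlam : mu < lam) (x : ℝ) (h : ℕ) :
    Summable (momentTerm lam mu x h) := by
  -- Any nonzero `t` with `|t| < 1` would do: the constant factor `t ^ h` is cancelled.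
  have h1 := (hasSum_exp_neg_sqrt (t := 1 / 2) ((lam - mu) * x / 2) (sq_nonneg _)
    (sqrt_ratio_sq_le_one hmu hlam) (by norm_num [abs_of_pos])).1 h
  simp only [← momentTerm_mul_pow] at h1
  exact (summable_mul_right_iff (by positivity)).1 h1

lemma hasSum_exp_neg_sqrt_disc (hmu : 0 < mu) (hlam : mu < lam) (x : ℝ) {s : ℝ}
    (hs : |s| < (√lam - √mu) ^ 2 / 2) :
    HasSum (fun h => (∑' j, momentTerm lam mu x h j) * (-(2 / (√lam - √mu) ^ 2)) ^ h * s ^ h)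
      (Real.exp (-(x / 2 * √(disc lam mu s)))) := by
  have hlam0 : 0 < lam := hmu.trans hlam
  have h1 := Real.sqrt_pos.2 hmu
  have h2 := Real.sqrt_lt_sqrt hmu.le hlam
  have h3 : 0 < √lam - √mu := by linarith
  have h4 : 0 < √lam + √mu := by linarith
  -- With this scaling the two factors of `disc_eq` become `(√lam - √mu) ^ 2 * (1 + t)` and `(√lam +
  -- √mu) ^ 2 * (1 + z * t)`, where `z` is the squared ratio, and the bound on `|s|` becomes `|t| <
  -- 1`.
  set t := -(2 / (√lam - √mu) ^ 2) * s with ht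
  have ht1 : |t| < 1 := by
    rw [ht, abs_mul, abs_neg, abs_of_pos (by positivity), div_mul_eq_mul_div,
      div_lt_one (by positivity)]
    linarith
  have h5 := (hasSum_exp_neg_sqrt (t := t) ((lam - mu) * x / 2) (sq_nonneg _)
    (sqrt_ratio_sq_le_one hmu hlam) ht1).2
  simp only [← momentTerm_mul_pow] at h5
  have hsq : √(disc lam mu s) = (lam - mu) *
      √((1 + t) * (1 + ((√lam - √mu) / (√lam + √mu)) ^ 2 * t)) := by
    rw [← Real.sqrt_sq (by linarith : 0 ≤ lam - mu), ← Real.sqrt_mul (sq_nonneg _), disc_eq hmu hlam0]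
    congr 1
    have h6 : lam - mu = (√lam - √mu) * (√lam + √mu) := by
      nlinarith [Real.sq_sqrt hmu.le, Real.sq_sqrt hlam0.le]
    rw [ht, h6]
    field_simp
    ring
  have hval : -((lam - mu) * x / 2) *
      √((1 + t) * (1 + ((√lam - √mu) / (√lam + √mu)) ^ 2 * t)) =
      -(x / 2 * √(disc lam mu s)) := by
    rw [hsq]; ring
  rw [hval] at h5
  refine h5.congr_fun fun h => ?_
  rw [tsum_mul_right, ht, mul_pow, mul_assoc]

lemma hypergeometric_coeff_eq (n h : ℕ) (hn : h ≤ n) :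
    ₂F₁ ((1 + n - h : ℝ) / 2) ((2 + n - h : ℝ) / 2) 2 (4 * lam * mu / (lam + mu) ^ 2) =
      ∑' k : ℕ, (catalan k : ℝ) * (((n - h) + 2 * k).choose (2 * k)) *
        (lam * mu / (lam + mu) ^ 2) ^ k := by
  rw [← ordinaryHypergeometric_eq_tsum_catalan, Nat.cast_sub hn, add_sub_assoc, add_sub_assoc]
  congr 1
  ring

/-- Near `0` the moment generating function is analytic with coefficients the moments over `n!`;
power series coefficients are unique. -/
lemma integral_pow_eq {Ω : Type*} [MeasurableSpace Ω] {P : Measure Ω} {X : Ω → ℝ} {r : ℝ}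
    (hr : 0 < r) (hint : ∀ s < r, Integrable (fun ω => Real.exp (s * X ω)) P) {c : ℕ → ℝ}
    (hc : ∀ s, |s| < r → HasSum (fun n => c n * s ^ n) (mgf X P s)) (n : ℕ) :
    Integrable (fun ω => X ω ^ n) P ∧ ∫ ω, X ω ^ n ∂P = n.factorial * c n := by
  have h0 : 0 ∈ interior (integrableExpSet X P) :=
    mem_interior.2 ⟨Set.Iio r, fun s hs => hint s hs, isOpen_Iio, hr⟩
  refine ⟨integrable_pow_of_mem_interior_integrableExpSet h0 n, ?_⟩
  have h1 : HasFPowerSeriesAt (mgf X P) (FormalMultilinearSeries.ofScalars ℝ c) 0 := by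
    rw [hasFPowerSeriesAt_iff]
    filter_upwards [Metric.ball_mem_nhds (0 : ℝ) hr] with s hs
    rw [mem_ball_zero_iff, Real.norm_eq_abs] at hs
    rw [zero_add]
    refine (hc s hs).congr_fun fun k => ?_
    rw [FormalMultilinearSeries.coeff_ofScalars, smul_eq_mul, mul_comm]
  have h2 := (FormalMultilinearSeries.ofScalars_series_eq_iff ℝ _ _).1
    ((hasFPowerSeriesAt_mgf h0).eq_formalMultilinearSeries h1)
  rw [← h2]
  simp only [zero_mul, Real.exp_zero, mul_one]
  field_simp

end Moments

end

end Telegraph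

theorem mainTheorem10 {Ω : Type*} [MeasurableSpace Ω] (P : Measure Ω) [IsProbabilityMeasure P]
    (lam mu x : ℝ) (hmu : 0 < mu) (hlam : mu < lam) (hx : 0 < x)
    (U D : ℕ → Ω → ℝ)
    (hU : ∀ i, HasLaw (U i) (expMeasure lam) P)
    (hD : ∀ i, HasLaw (D i) (expMeasure mu) P)
    (hind : iIndepFun (Sum.elim U D) P) :
    -- the origin is reached almost surely, from `x` and from `0`
    (∀ᵐ ω ∂P, (Telegraph.hitTimes x (fun i => U i ω) (fun i => D i ω)).Nonempty) ∧
    (∀ᵐ ω ∂P, (Telegraph.hitTimes 0 (fun i => U i ω) (fun i => D i ω)).Nonempty) ∧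
    -- the factorization of the moment generating function
    (∀ s : ℝ, s < (√lam - √mu) ^ 2 / 2 →
      Integrable (fun ω => Real.exp (s * Telegraph.arrivalTime x U D ω)) P ∧
      Integrable (fun ω => Real.exp (s * Telegraph.arrivalTime 0 U D ω)) P ∧
      mgf (Telegraph.arrivalTime x U D) P s =
        mgf (Telegraph.arrivalTime 0 U D) P s *
          Real.exp (x / 2 * (lam - mu - √((lam + mu - 2 * s) ^ 2 - 4 * lam * mu)))) ∧
    -- the products in the series are well defined, as limits where they need to be
    (∀ h j : ℕ, Tendsto
      (Telegraph.binomHypRaw h (((√lam - √mu) / (√lam + √mu)) ^ 2)) (𝓝[≠] ((j : ℝ) / 2))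
      (𝓝 (Telegraph.binomHyp h (((√lam - √mu) / (√lam + √mu)) ^ 2) ((j : ℝ) / 2)))) ∧
    -- the series converge
    (∀ h : ℕ, Summable (Telegraph.momentTerm lam mu x h)) ∧
    -- the moments
    ∀ n : ℕ, 1 ≤ n →
      Integrable (fun ω => Telegraph.arrivalTime x U D ω ^ n) P ∧
      ∫ ω, Telegraph.arrivalTime x U D ω ^ n ∂P =
        (n.factorial : ℝ) * (lam / (lam + mu)) * Real.exp (x / 2 * (lam - mu)) *
          (2 ^ n / (lam + mu) ^ n) *
          ∑ h ∈ Finset.range (n + 1),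
            (-((lam + mu) / (√lam - √mu) ^ 2)) ^ h *
              ₂F₁ ((1 + n - h : ℝ) / 2) ((2 + n - h : ℝ) / 2) 2
                (4 * lam * mu / (lam + mu) ^ 2) *
              ∑' j : ℕ, Telegraph.momentTerm lam mu x h j := by
  obtain ⟨hx1, hx2⟩ := Telegraph.arrivalTime_spec hmu hlam hU hD hind hx.le
  obtain ⟨h01, h02⟩ := Telegraph.arrivalTime_spec hmu hlam hU hD hind (le_refl (0 : ℝ))
  have hlam0 : 0 < lam := hmu.trans hlam
  have hr : 0 < (√lam - √mu) ^ 2 / 2 := by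
    have : 0 < √lam - √mu := sub_pos.2 (Real.sqrt_lt_sqrt hmu.le hlam)
    positivity
  have hr' : (√lam - √mu) ^ 2 ≠ 0 := fun h => by simp [h] at hr
  refine ⟨hx1, h01, fun s hs => ⟨(hx2 s hs).1, (h02 s hs).1, ?_⟩, fun h j => ?_,
    Telegraph.summable_momentTerm hmu hlam x, fun n _ => ?_⟩
  · rw [(hx2 s hs).2, (h02 s hs).2, zero_div, zero_mul, Real.exp_zero, mul_one, Telegraph.disc]
  · rw [Telegraph.binomHyp_eq]
    exact Telegraph.tendsto_binomHypRaw h j _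
  -- The coefficients `c` are those of the Cauchy product of the series for `exp (-(x / 2 * R))` and
  -- for `returnMgf`.
  · have hkey := Telegraph.integral_pow_eq hr (fun s hs => (hx2 s hs).1)
      (c := fun n => Real.exp (x / 2 * (lam - mu)) * ∑ h ∈ Finset.range (n + 1),
        ((∑' j, Telegraph.momentTerm lam mu x h j) * (-(2 / (√lam - √mu) ^ 2)) ^ h) *
        (lam / (lam + mu) * (2 / (lam + mu)) ^ (n - h) *
          ∑' k : ℕ, (catalan k : ℝ) * (((n - h) + 2 * k).choose (2 * k)) *
            (lam * mu / (lam + mu) ^ 2) ^ k)) (fun s hs => ?_) n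
    · refine ⟨hkey.1, ?_⟩
      rw [hkey.2, Finset.mul_sum, Finset.mul_sum, Finset.mul_sum]
      refine Finset.sum_congr rfl fun h hh => ?_
      have hn : h ≤ n := Nat.lt_succ_iff.1 (Finset.mem_range.1 hh)
      rw [Telegraph.hypergeometric_coeff_eq n h hn]
      obtain ⟨m, rfl⟩ := Nat.exists_eq_add_of_le hn
      rw [Nat.add_sub_cancel_left]
      have hL : lam + mu ≠ 0 := by positivity
      have hpow : (-(2 / (√lam - √mu) ^ 2)) ^ h * (2 / (lam + mu)) ^ m =
          2 ^ (h + m) / (lam + mu) ^ (h + m) * (-((lam + mu) / (√lam - √mu) ^ 2)) ^ h := by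
        rw [← div_pow, pow_add, mul_right_comm, ← mul_pow]
        congr 2
        field_simp
      linear_combination ((h + m).factorial : ℝ) * Real.exp (x / 2 * (lam - mu)) *
        (∑' j, Telegraph.momentTerm lam mu x h j) * (lam / (lam + mu)) *
        (∑' k : ℕ, (catalan k : ℝ) * ((m + 2 * k).choose (2 * k)) *
            (lam * mu / (lam + mu) ^ 2) ^ k) * hpow
    · have hA := Telegraph.hasSum_returnMgf hmu hlam hs
      have hB := Telegraph.hasSum_exp_neg_sqrt_disc hmu hlam x hs
      have hAB := (hasSum_sum_range_mul_of_summable_norm hB.summable.norm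
        hA.summable.norm).mul_left (Real.exp (x / 2 * (lam - mu)))
      rw [hA.tsum_eq, hB.tsum_eq] at hAB
      have hval : Real.exp (x / 2 * (lam - mu)) *
          (Real.exp (-(x / 2 * √(Telegraph.disc lam mu s))) * Telegraph.returnMgf lam mu s) =
          mgf (Telegraph.arrivalTime x U D) P s := by
        rw [(hx2 s ((le_abs_self s).trans_lt hs)).2, ← mul_assoc, ← Real.exp_add, mul_comm]
        congr 2
        ring
      rw [hval] at hAB
      refine hAB.congr_fun fun n => ?_
      rw [mul_assoc, Finset.sum_mul]
      congr 1
      refine Finset.sum_congr rfl fun h hh => ?_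
      have : s ^ n = s ^ h * s ^ (n - h) := by
        rw [← pow_add, Nat.add_sub_cancel' (Nat.lt_succ_iff.1 (Finset.mem_range.1 hh))]
      rw [this]
      ring
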